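/- **Setting.** Let $\mathcal H_0=\mathcal H=\mathbb C^2$ with orthonormal basis $(X_0,X_1)=(\Omega,X)$, let $\beta=|\Omega\rangle\langle\Omega|$, $P_0=|\Omega\rangle\langle\Omega|$, $P_1=|X\rangle\langle X|$ (the eigenprojectors of a diagonal observable), and let $n\ge 1$, $h=1/n$. For every $k\ge 1$ and every control value $a\in\mathbb R^d$ let $U_k(a)$ be a unitary operator on $\mathcal H_0\otimes\mathcal H$, let $u:\mathbb R\times \mathcal B(\mathcal H_0)\to\mathbb R^d$ be a function (a Markovian control strategy), and let $\rho$ be a state on $\mathcal H_0$ (a positive semidefinite operator of trace one). *Repeated measurements.* Let $\Gamma=\mathcal H_0\otimes\bigotimes_{k\ge1}\mathcal H_k$, where each $\mathcal H_k$ is a copy of $\mathcal H$ and the tensor product is taken with respect to $\Omega$, and let $\mu=\rho\otimes\bigotimes_{k\ge 1}\beta$. For an operator $M$ on $\mathcal H_0\otimes\mathcal H$ denote by $M^{(k)}$ the operator on $\Gamma$ which acts as $M$ on $\mathcal H_0\otimes\mathcal H_k$ and as the identity on the other factors, and put $P_i^k=(I\otimes P_i)^{(k)}$. Let $\mathbf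 E_0$ be the partial trace on $\mathcal H_0$. For $\omega=(\omega_1,\omega_2,\dots)\in\{0,1\}^{\mathbb N^*}$ define recursively $V_0(\omega)=I$, $$\tilde\mu_k(\omega)=P^k_{\omega_k}\cdots P^1_{\omega_1}\,V_k(\omega)\,\mu\, V_k(\omega)^\star\,P^1_{\omega_1}\cdots P^k_{\omega_k},\qquad \rho_k^{\mathbf u}(\omega)=\mathbf E_0\!\left[\frac{\tilde\mu_k(\omega)}{\mathrm{Tr}[\tilde\mu_k(\omega)]}\right],$$ $$V_{k+1}(\omega)=\Big(U_{k+1}\big(u(k/n,\rho_k^{\mathbf u}(\omega))\big)\Big)^{(k+1)}V_k(\omega),$$ where a quotient by a zero trace is read as $0$. The sequence $(\rho^{\mathbf u}_k)$ is the discrete controlled quantum trajectory. The law of the measurement results is the probability measure $P$ on $\{0,1\}^{\mathbb N^*}$ (with the cylinder $\sigma$-algebra) such that $P\{\omega:\omega_1=i_1,\dots,\omega_k=i_k\}=\mathrm{Tr}[\tilde\mu_k(i_1,\dots,i_k)]$ for all $k\ge 0$ and all $i_1,\dots,i_k$. *Coupling.* For an operator $\eta$ on $\mathcal H_0$, $k\ge0$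 and $i\in\{0,1\}$ put, with $U=U_{k+1}(u(k/n,\eta))$, $$\mathcal L_i^{k+1}(\eta)=\mathbf E_0\big[(I\otimes P_i)\,U(\eta\otimes\beta)U^\star\,(I\otimes P_i)\big],$$ where here $\mathbf E_0$ is the partial trace of operators on $\mathcal H_0\otimes\mathcal H$ onto $\mathcal H_0$. Let $N$ be a Poisson point process on $\mathbb R^2$ with Lebesgue intensity, on some probability space, and put $$G_k(\eta)=\Big\{(t,v)\in\mathbb R^2:\ \tfrac kn\le t<\tfrac{k+1}n,\ 0\le v\le -n\ln \mathrm{Tr}[\mathcal L_0^{k+1}(\eta)]\Big\}$$ (with $-\ln 0=+\infty$), $\tilde\nu_{k+1}(\eta)=\mathbf 1_{N(G_k(\eta))>0}$. Define $\tilde\rho_0^{\mathbf u}=\rho$ and $$\tilde\rho^{\mathbf u}_{k+1}=\mathcal L^{k+1}_0(\tilde\rho^{\mathbf u}_k)+\mathcal L^{k+1}_1(\tilde\rho^{\mathbf u}_k)+\left[-\frac{\mathcal L^{k+1}_0(\tilde\rho^{\mathbf u}_k)}{\mathrm{Tr}[\mathcal L^{k+1}_0(\tilde\rho^{\mathbf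 u}_k)]}+\frac{\mathcal L^{k+1}_1(\tilde\rho^{\mathbf u}_k)}{\mathrm{Tr}[\mathcal L^{k+1}_1(\tilde\rho^{\mathbf u}_k)]}\right]\Big(\tilde\nu_{k+1}(\tilde\rho^{\mathbf u}_k)-\mathrm{Tr}[\mathcal L^{k+1}_1(\tilde\rho^{\mathbf u}_k)]\Big),$$ where a quotient by a zero trace is read as $0$. **Proposition.** There is exactly one law $P$ of the measurement results as above, and for every $T\ge0$ the process $(\tilde\rho^{\mathbf u}_k)_{0\le k\le[nT]}$, on the probability space of $N$, has the same distribution as the discrete controlled quantum trajectory $(\rho^{\mathbf u}_k)_{0\le k\le[nT]}$ under $P$. -/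

import Mathlib

open MeasureTheory ProbabilityTheory Matrix
open scoped ENNReal NNReal ComplexOrder

noncomputable section

namespace QuantumTrajectory

/-! ### The state space of the atom and the infinite chain -/

/-- Operators on the atom `ℋ₀ = ℂ²`, in the orthonormal basis `X₀ = Ω`, `X₁ = X`. -/
abbrev Op := Matrix (Fin 2) (Fin 2) ℂ

/-- Operators on `ℋ₀ ⊗ ℋ = ℂ² ⊗ ℂ²`; the index `(a, i)` stands for `X_a ⊗ X_i`. -/
abbrev Op₂ := Matrix (Fin 2 × Fin 2) (Fin 2 × Fin 2) ℂ

/-- A state on `ℂ²`: a positive semidefinite matrix of trace one. -/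
def IsState (ρ : Op) : Prop := ρ.PosSemidef ∧ ρ.trace = 1

/-- Configurations of the atom and the chain. The pair `(a, c)` labels the basis vector
`X_a ⊗ X_{c 0} ⊗ X_{c 1} ⊗ ⋯`, in which all but finitely many factors are the ground state
`X₀ = Ω`. Site `k` of the chain is the copy of `ℋ` used in interaction number `k + 1`. -/
abbrev Config := Fin 2 × (ℕ →₀ Fin 2)

/-- The Hilbert space `Γ = ℋ₀ ⊗ ⨂_{k ≥ 1} ℋ_k`, the tensor product being taken with respect to the
ground state `Ω`, through its orthonormal basis indexed by `Config`. -/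
abbrev Γ := lp (fun _ : Config => ℂ) 2

/-- The basis vector of `Γ` with label `x`. -/
def ket (x : Config) : Γ := lp.single 2 x (1 : ℂ)

/-- Pulling back along a map that is injective on `s`, and extending by zero, preserves `ℓ²`. -/
theorem partialPull_aux {ι : Type*} (s : Set ι) [DecidablePred (· ∈ s)] (φ : ι → ι)
    (hφ : Set.InjOn φ s) (f : lp (fun _ : ι => ℂ) 2) (t : Finset ι) :
    ∑ x ∈ t, ‖(if x ∈ s then f (φ x) else 0 : ℂ)‖ ^ (2 : ℝ≥0∞).toReal
      ≤ ‖f‖ ^ (2 : ℝ≥0∞).toReal := by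
  classical
  have h2 : 0 < (2 : ℝ≥0∞).toReal := by norm_num
  have hinj : Set.InjOn φ (t.filter (· ∈ s) : Finset ι) := fun x hx y hy h =>
    hφ (by simpa using (Finset.mem_filter.1 hx).2) (by simpa using (Finset.mem_filter.1 hy).2) h
  calc ∑ x ∈ t, ‖(if x ∈ s then f (φ x) else 0 : ℂ)‖ ^ (2 : ℝ≥0∞).toReal
      = ∑ x ∈ t.filter (· ∈ s), ‖f (φ x)‖ ^ (2 : ℝ≥0∞).toReal := by
        rw [Finset.sum_filter]
        refine Finset.sum_congr rfl fun x _ => ?_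
        split_ifs
        · rfl
        · simp
    _ = ∑ y ∈ (t.filter (· ∈ s)).image φ, ‖f y‖ ^ (2 : ℝ≥0∞).toReal :=
        (Finset.sum_image (f := fun y => ‖f y‖ ^ (2 : ℝ≥0∞).toReal) hinj).symm
    _ ≤ ‖f‖ ^ (2 : ℝ≥0∞).toReal := lp.sum_rpow_le_norm_rpow h2 f _

/-- The bounded operator on `ℓ²` given by pulling back along a map that is injective on `s`, and
extending by zero outside `s`. -/
def partialPull {ι : Type*} (s : Set ι) [DecidablePred (· ∈ s)] (φ : ι → ι)
    (hφ : Set.InjOn φ s) : lp (fun _ : ι => ℂ) 2 →L[ℂ] lp (fun _ : ι => ℂ) 2 :=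
  LinearMap.mkContinuous
    { toFun := fun f => ⟨fun x => if x ∈ s then f (φ x) else 0,
        memℓp_gen' (partialPull_aux s φ hφ f)⟩
      map_add' := fun f g => by
        ext x
        change (if x ∈ s then (f + g) (φ x) else 0) =
          (if x ∈ s then f (φ x) else 0) + (if x ∈ s then g (φ x) else 0)
        by_cases h : x ∈ s <;> simp [h]
      map_smul' := fun c f => by
        ext x
        by_cases h : x ∈ s <;> simp [h] }
    1 (fun f => by
      rw [one_mul]
      exact lp.norm_le_of_forall_sum_le (by norm_num) (norm_nonneg _)
        (partialPull_aux s φ hφ f))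

/-- The operator `|X_a ⊗ X_i⟩⟨X_b ⊗ X_j|` on the atom and site `k`, acting as the identity on all
other sites. -/
def elementary (k : ℕ) (a i b j : Fin 2) : Γ →L[ℂ] Γ :=
  partialPull {x : Config | x.1 = a ∧ x.2 k = i} (fun x => (b, x.2.update k j)) (by
    rintro ⟨a₁, c₁⟩ ⟨h₁, h₁'⟩ ⟨a₂, c₂⟩ ⟨h₂, h₂'⟩ h
    simp only [Prod.mk.injEq, true_and] at h h₁ h₂ h₁' h₂' ⊢
    refine ⟨h₁.trans h₂.symm, Finsupp.ext fun l => ?_⟩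
    by_cases hl : l = k
    · rw [hl, h₁', h₂']
    · simpa [Finsupp.update_apply, hl] using DFunLike.congr_fun h l)

/-- The operator on `Γ` which acts as `M` on the atom and site `k` of the chain, and as the
identity on all other sites. -/
def amplify (k : ℕ) (M : Op₂) : Γ →L[ℂ] Γ :=
  ∑ x : Fin 2 × Fin 2, ∑ y : Fin 2 × Fin 2, M x y • elementary k x.1 x.2 y.1 y.2

theorem amplify_apply (k : ℕ) (M : Op₂) (f : Γ) (a : Fin 2) (c : ℕ →₀ Fin 2) :
    amplify k M f (a, c) = ∑ y : Fin 2 × Fin 2, M (a, c k) y * f (y.1, c.update k y.2) := by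
  have h : amplify k M f (a, c) = ∑ x : Fin 2 × Fin 2, ∑ y : Fin 2 × Fin 2,
      M x y * (if a = x.1 ∧ c k = x.2 then f (y.1, c.update k y.2) else 0) := by
    simp only [amplify, _root_.sum_apply, lp.coeFn_sum, Finset.sum_apply]
    rfl
  rw [h, Finset.sum_eq_single (a, c k)]
  · simp
  · rintro ⟨a', i'⟩ _ hne
    refine Finset.sum_eq_zero fun y _ => ?_
    rw [if_neg, mul_zero]
    rintro ⟨rfl, rfl⟩
    exact hne rfl
  · simp

/-- The trace on `Γ`. -/
def traceΓ (T : Γ →L[ℂ] Γ) : ℂ := ∑' x : Config, inner ℂ (ket x) (T (ket x))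

/-- The partial trace `E₀` on the atom, with respect to the chain. -/
def E₀ (α : Γ →L[ℂ] Γ) : Op :=
  Matrix.of fun a b => ∑' c : ℕ →₀ Fin 2, inner ℂ (ket (a, c)) (α (ket (b, c)))

/-- The initial state `ρ ⊗ ⨂_{k ≥ 1} β` on `Γ`, with `β = |Ω⟩⟨Ω|`. -/
def initialState (ρ : Op) : Γ →L[ℂ] Γ :=
  ∑ a : Fin 2, ∑ b : Fin 2, ρ a b • InnerProductSpace.rankOne ℂ (ket (a, 0)) (ket (b, 0))

/-- The eigenprojectors `P₀ = |Ω⟩⟨Ω|` and `P₁ = |X⟩⟨X|` of a diagonal observable on `ℋ`. -/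
def proj (i : Fin 2) : Op := Matrix.single i i 1

/-- The ampliation to `Γ` of the eigenprojector `P_i` at site `k`. -/
def siteProj (k : ℕ) (i : Fin 2) : Γ →L[ℂ] Γ := amplify k (kroneckerMap (· * ·) (1 : Op) (proj i))

/-! ### Repeated measurements with control -/

section Trajectory

variable {d : ℕ} (n : ℕ) (U : ℕ → EuclideanSpace ℝ (Fin d) → unitaryGroup (Fin 2 × Fin 2) ℂ)
  (u : ℝ → Op → EuclideanSpace ℝ (Fin d)) (ρ : Op)

/-- The unitary operator `U_{k+1}(h, u_k(h))` on `ℋ₀ ⊗ ℋ`, with `h = 1/n`, when the Markovian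
strategy `u` is applied in the state `η` of the atom: `u_k(h) = u(k h, η)`. -/
def stepUnitary (k : ℕ) (η : Op) : Op₂ := (U (k + 1) (u ((k : ℝ) / n) η) : Op₂)

/-- The operator `P^k_{ω_k} ⋯ P^1_{ω_1}`. The result of the `(k + 1)`-st measurement is `ω k`. -/
def projections (ω : ℕ → Fin 2) : ℕ → (Γ →L[ℂ] Γ)
  | 0 => 1
  | k + 1 => siteProj k (ω k) * projections ω k

/-- The non-normalized state `Π V μ V⋆ Π⋆` on `Γ`: interactions `V`, then projections `Π`. -/
def unnormalized (V : Γ →L[ℂ] Γ) (ω : ℕ → Fin 2) (k : ℕ) : Γ →L[ℂ] Γ :=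
  projections ω k * (V * initialState ρ * star V) * star (projections ω k)

/-- The normalized state. -/
def normalized (V : Γ →L[ℂ] Γ) (ω : ℕ → Fin 2) (k : ℕ) : Γ →L[ℂ] Γ :=
  (traceΓ (unnormalized ρ V ω k))⁻¹ • unnormalized ρ V ω k

/-- The unitary operator `V_k = U_k(h, u_{k-1}(h)) ⋯ U_1(h, u_0(h))` describing the first `k`
interactions; the control `u_k(h)` is computed from the reduced state `E₀` after `k` measurements
with results `ω`. -/
def evolution (ω : ℕ → Fin 2) : ℕ → (Γ →L[ℂ] Γ)
  | 0 => 1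
  | k + 1 => amplify k (stepUnitary n U u k (E₀ (normalized ρ (evolution ω k) ω k))) *
      evolution ω k

/-- The non-normalized state `μ̃_k(ω_1, …, ω_k)` on `Γ` after `k` interactions and measurements. -/
def muTilde (k : ℕ) (ω : ℕ → Fin 2) : Γ →L[ℂ] Γ :=
  unnormalized ρ (evolution n U u ρ ω k) ω k

/-- The discrete controlled quantum trajectory on `ℋ₀`: the partial trace of the normalized state
`μ̃_k / Tr[μ̃_k]`. -/
def trajectory (k : ℕ) (ω : ℕ → Fin 2) : Op :=
  E₀ ((traceΓ (muTilde n U u ρ k ω))⁻¹ • muTilde n U u ρ k ω)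

/-- `P` is the law of the measurement results: a probability measure on the space of sequences
whose value on the cylinder of `(i_1, …, i_k)` is `Tr[μ̃_k(i_1, …, i_k)]`. -/
def IsMeasurementLaw (P : Measure (ℕ → Fin 2)) : Prop :=
  IsProbabilityMeasure P ∧ ∀ (k : ℕ) (i : ℕ → Fin 2),
    ((P.real {ω | ∀ j < k, ω j = i j} : ℝ) : ℂ) = traceΓ (muTilde n U u ρ k i)

/-! ### The coupling with a Poisson point process -/

/-- The partial trace on `ℋ₀` of an operator on `ℋ₀ ⊗ ℋ`. -/
def partialTrace (M : Op₂) : Op := Matrix.of fun a b => ∑ i, M (a, i) (b, i)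

/-- `ℒ_i^{k+1}(η) = E₀[(I ⊗ P_i) U_{k+1} (η ⊗ β) U_{k+1}⋆ (I ⊗ P_i)]`. -/
def transition (k : ℕ) (i : Fin 2) (η : Op) : Op :=
  partialTrace (kroneckerMap (· * ·) (1 : Op) (proj i) * stepUnitary n U u k η *
    kroneckerMap (· * ·) η (Matrix.single 0 0 1 : Op) * (stepUnitary n U u k η)ᴴ *
    kroneckerMap (· * ·) (1 : Op) (proj i))

/-- The region `G_k(η)` of the plane. The upper bound for the second coordinate is an extended
real number, equal to `+∞` when `Tr[ℒ_0^{k+1}(η)] = 0`. -/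
def region (k : ℕ) (η : Op) : Set (ℝ × ℝ) :=
  {x | (k : ℝ) / n ≤ x.1 ∧ x.1 < ((k : ℝ) + 1) / n ∧ 0 ≤ x.2 ∧
    (x.2 : EReal) ≤ -((n : ℝ) : EReal) *
      ENNReal.log (ENNReal.ofReal (transition n U u k 0 η).trace.re)}

/-- The indicator that the counting measure `N` has a point in `G_k(η)`. -/
def nuTilde (N : Measure (ℝ × ℝ)) (k : ℕ) (η : Op) : ℂ :=
  open Classical in if 0 < N (region n U u k η) then 1 else 0

/-- The process defined recursively from the point configuration `N`. A quotient by a vanishing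
trace is read as zero. -/
def coupled (N : Measure (ℝ × ℝ)) : ℕ → Op
  | 0 => ρ
  | k + 1 =>
    let η := coupled N k
    let L₀ := transition n U u k 0 η
    let L₁ := transition n U u k 1 η
    L₀ + L₁ + (nuTilde n U u N k η - L₁.trace) • (-(L₀.trace⁻¹ • L₀) + L₁.trace⁻¹ • L₁)

end Trajectory

/-- `N` is a Poisson point process on `E` with intensity measure `m`, on the probability space
`(Ω, Pr)`: a random counting measure, such that the number of points in a measurable set of finite
intensity has the Poisson distribution, and the numbers of points in disjoint sets are
independent. -/
structure IsPoissonPointProcess {Ω E : Type*} [MeasurableSpace Ω] [MeasurableSpace E]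
    (N : Ω → Measure E) (m : Measure E) (Pr : Measure Ω) : Prop where
  measurable : Measurable N
  counting : ∀ ω, ∀ B : Set E, MeasurableSet B → ∃ p : ℕ∞, N ω B = (p : ℝ≥0∞)
  law : ∀ B : Set E, MeasurableSet B → m B ≠ ∞ →
    Pr.map (fun ω => N ω B) = (poissonMeasure (m B).toNNReal).map (fun p : ℕ => (p : ℝ≥0∞))
  indep : ∀ (r : ℕ) (B : Fin r → Set E), (∀ i, MeasurableSet (B i)) →
    Pairwise (fun i j => Disjoint (B i) (B j)) → iIndepFun (fun i ω => N ω (B i)) Pr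

end QuantumTrajectory

end

noncomputable section

namespace QuantumTrajectory

/-! ### Operators on the chain with a definite configuration of the sites -/

/-! Everything reduces to a two-dimensional recursion, and the coupled process is the quantum
trajectory read along its own random results, path by path.

On the chain, site `k` is still in the ground state when it meets the atom, and earlier projections
commute with later interactions. Hence the non-normalized state always has the form `A ⊗ |c⟩⟨c|`,
with `c` recording the results (`muTilde_eq_embed`), and one step turns `A` into `K A Kᴴ` for a
Kraus operator `K`. So the trajectory moves from `η` to `ℒ_i(η) / Tr ℒ_i(η)` (`trajectory_succ`),
and the weight of a cylinder is the product of the traces of the transitions along it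
(`traceΓ_muTilde_eq_prod`).

On the Poisson side, `Tr ℒ_0 + Tr ℒ_1 = 1` makes the recursion for the coupled process collapse to
the same quotient, with `i` the indicator of a point in the region (`coupled_step`). Once a cylinder
of results is fixed, the regions are no longer random. They lie in disjoint time strips, so the
counts in them are independent, and a region has area `-ln Tr ℒ_0`, so it is empty with probability
`Tr ℒ_0`. Thus the results follow the measurement law (`measure_results_cylinder`), which proves
existence of that law; cylinders form a generating π-system, which gives uniqueness. Equality in
distribution is then a composition of pushforwards. -/

theorem ket_apply (x y : Config) : ket x y = if y = x then 1 else 0 := by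
  rw [ket, lp.single_apply]
  by_cases h : y = x
  · subst h; simp
  · simp [h]

theorem inner_ket_left (x : Config) (f : Γ) : inner ℂ (ket x) f = f x := by
  rw [ket, lp.inner_single_left]
  simp

theorem siteProj_apply (k : ℕ) (i : Fin 2) (f : Γ) (a : Fin 2) (c : ℕ →₀ Fin 2) :
    siteProj k i f (a, c) = if c k = i then f (a, c) else 0 := by
  rw [siteProj, amplify_apply, Finset.sum_eq_single (a, c k)]
  · by_cases h : c k = i
    · subst h; simp [proj]
    · have h' : i ≠ c k := fun e => h e.symm
      simp [proj, h, h']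
  · rintro ⟨b, j⟩ _ hne
    by_cases hb : a = b
    · subst hb
      have : c k ≠ j := fun e => hne (by rw [e])
      have h2 : ¬ (i = c k ∧ i = j) := fun e => this (e.1.symm.trans e.2)
      simp [proj, h2]
    · simp [hb]
  · simp

/-- The projector is diagonal in the basis and looks only at coordinate `j`, which an operator on
the atom and another site leaves unchanged. -/
theorem siteProj_mul_amplify_of_ne {j k : ℕ} (h : j ≠ k) (i : Fin 2) (M : Op₂) :
    siteProj j i * amplify k M = amplify k M * siteProj j i := by
  ext f ⟨a, c⟩
  change siteProj j i (amplify k M f) (a, c) = amplify k M (siteProj j i f) (a, c)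
  rw [siteProj_apply, amplify_apply, amplify_apply]
  simp only [siteProj_apply, Finsupp.update_apply, if_neg h]
  split_ifs <;> simp

theorem projections_mul_amplify (ω : ℕ → Fin 2) (M : Op₂) {j k : ℕ} (h : j ≤ k) :
    projections ω j * amplify k M = amplify k M * projections ω j := by
  induction j with
  | zero => simp [projections]
  | succ j ih =>
    rw [projections, mul_assoc, ih (by omega), ← mul_assoc,
      siteProj_mul_amplify_of_ne (by omega), mul_assoc]

/-- The operator `A ⊗ |c⟩⟨c|` on `Γ`. -/
def embed (A : Op) (c : ℕ →₀ Fin 2) : Γ →L[ℂ] Γ :=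
  ∑ a : Fin 2, ∑ b : Fin 2, A a b • InnerProductSpace.rankOne ℂ (ket (a, c)) (ket (b, c))

theorem inner_ket_embed (A : Op) (c : ℕ →₀ Fin 2) (x y : Config) :
    inner ℂ (ket x) (embed A c (ket y)) = if x.2 = c ∧ y.2 = c then A x.1 y.1 else 0 := by
  obtain ⟨a, c₁⟩ := x
  obtain ⟨b, c₂⟩ := y
  rw [inner_ket_left]
  simp only [embed, _root_.sum_apply, lp.coeFn_sum, Finset.sum_apply]
  simp only [_root_.smul_apply, InnerProductSpace.rankOne_apply, inner_ket_left, lp.coeFn_smul,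
    Pi.smul_apply, smul_eq_mul, ket_apply, Prod.mk.injEq]
  by_cases h₁ : c₁ = c <;> by_cases h₂ : c₂ = c
  · have h₂' : c = c₂ := h₂.symm
    subst h₁; subst h₂'
    fin_cases a <;> fin_cases b <;> simp
  · have h₂' : ¬ c = c₂ := fun e => h₂ e.symm
    simp [h₂, h₂']
  · simp [h₁]
  · simp [h₁]

theorem E₀_embed (A : Op) (c : ℕ →₀ Fin 2) : E₀ (embed A c) = A := by
  ext a b
  rw [E₀, Matrix.of_apply, tsum_eq_single c]
  · simp [inner_ket_embed]
  · intro c' h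
    simp [inner_ket_embed, h]

theorem traceΓ_embed (A : Op) (c : ℕ →₀ Fin 2) : traceΓ (embed A c) = A.trace := by
  rw [traceΓ, tsum_eq_sum (s := {((0 : Fin 2), c), ((1 : Fin 2), c)})]
  · rw [Finset.sum_pair (by simp)]
    simp [inner_ket_embed, Matrix.trace, Fin.sum_univ_two]
  · rintro ⟨a, c'⟩ h
    rw [inner_ket_embed, if_neg]
    rintro ⟨h₁, -⟩
    simp only at h₁
    subst h₁
    fin_cases a <;> simp at h

theorem smul_embed (z : ℂ) (A : Op) (c : ℕ →₀ Fin 2) : z • embed A c = embed (z • A) c := by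
  simp only [embed, Finset.smul_sum, Matrix.smul_apply, smul_eq_mul, mul_smul]

theorem conj_rankOne (S : Γ →L[ℂ] Γ) (x y : Γ) :
    S * InnerProductSpace.rankOne ℂ x y * star S = InnerProductSpace.rankOne ℂ (S x) (S y) := by
  ext1 f
  simp only [mul_apply_eq_comp, InnerProductSpace.rankOne_apply, map_smul,
    ContinuousLinearMap.star_eq_adjoint, ContinuousLinearMap.adjoint_inner_right]

/-- Only the action of `S` on the two vectors `X_b ⊗ c` matters, because conjugating `|x⟩⟨y|` by `S`
gives `|Sx⟩⟨Sy|`. -/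
theorem conj_embed (S : Γ →L[ℂ] Γ) (K A : Op) (c c' : ℕ →₀ Fin 2)
    (h : ∀ b, S (ket (b, c)) = ∑ a, K a b • ket (a, c')) :
    S * embed A c * star S = embed (K * A * Kᴴ) c' := by
  simp only [embed, Fin.sum_univ_two, mul_add, add_mul, mul_smul_comm, smul_mul_assoc,
    conj_rankOne]
  simp only [h, Fin.sum_univ_two, map_add, map_smul, map_smulₛₗ, _root_.add_apply,
    _root_.smul_apply, Matrix.mul_apply, Matrix.conjTranspose_apply, starRingEnd_apply]
  module

/-! ### Kraus operators -/

/-- The Kraus operator `⟨X_i| W |Ω⟩` on the atom. -/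
def kraus (W : Op₂) (i : Fin 2) : Op := Matrix.of fun a b => W (a, i) (b, 0)

/-- Since site `k` starts in `Ω`, only the columns `(b, 0)` of `W` contribute, and the projector
keeps only the rows `(a, i)`: these entries form the Kraus operator. -/
theorem siteProj_amplify_ket (k : ℕ) (i : Fin 2) (W : Op₂) (b : Fin 2) (c : ℕ →₀ Fin 2)
    (hc : c k = 0) :
    (siteProj k i * amplify k W) (ket (b, c)) = ∑ a, kraus W i a b • ket (a, c.update k i) := by
  ext ⟨a, c'⟩
  change siteProj k i (amplify k W (ket (b, c))) (a, c') = _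
  rw [siteProj_apply, amplify_apply]
  simp only [lp.coeFn_sum, Finset.sum_apply, lp.coeFn_smul, Pi.smul_apply, smul_eq_mul, ket_apply,
    Prod.mk.injEq]
  by_cases h : c' = c.update k i
  · have hk : c' k = i := by simp [h]
    have hu : ∀ j, c'.update k j = c ↔ j = 0 := by
      intro j
      constructor
      · intro e
        have := DFunLike.congr_fun e k
        simpa [hc] using this
      · rintro rfl
        ext1 l
        by_cases hl : l = k
        · subst hl; simp [hc]
        · simp [h, Finsupp.update_apply, hl]
    simp only [hk, hu, if_true]
    simp [h, Fintype.sum_prod_type, kraus]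
  · have hu : c' k = i → ∀ j, ¬ c'.update k j = c := by
      rintro hk j e
      apply h
      ext1 l
      by_cases hl : l = k
      · subst hl; simp [hk]
      · simp [← e, Finsupp.update_apply, hl]
    simp only [h, and_false, if_false, mul_zero, Finset.sum_const_zero]
    split_ifs with hk
    · simp [hu hk]
    · rfl

/-- The one-step map of the coupling is governed by the same Kraus operators as the chain; this is
the bridge between the two constructions. -/
theorem partialTrace_conj (W : Op₂) (i : Fin 2) (η : Op) :
    partialTrace (kroneckerMap (· * ·) (1 : Op) (proj i) * W *
      kroneckerMap (· * ·) η (Matrix.single 0 0 1 : Op) * Wᴴ *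
      kroneckerMap (· * ·) (1 : Op) (proj i)) = kraus W i * η * (kraus W i)ᴴ := by
  ext a b
  fin_cases i <;> fin_cases a <;> fin_cases b <;>
    simp [partialTrace, kraus, Matrix.mul_apply, Fintype.sum_prod_type, Fin.sum_univ_two, proj,
      Matrix.single_apply]

theorem sum_kraus {W : Op₂} (hW : W ∈ unitaryGroup (Fin 2 × Fin 2) ℂ) :
    (kraus W 0)ᴴ * kraus W 0 + (kraus W 1)ᴴ * kraus W 1 = 1 := by
  have h := (Matrix.mem_unitaryGroup_iff').1 hW
  ext a b
  have hab := congr_fun (congr_fun h (a, 0)) (b, 0)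
  simp only [Matrix.mul_apply, Fintype.sum_prod_type, Fin.sum_univ_two, Matrix.star_apply,
    Matrix.one_apply, Prod.mk.injEq, and_true] at hab
  simp only [Matrix.add_apply, Matrix.mul_apply, Fin.sum_univ_two, Matrix.conjTranspose_apply,
    kraus, Matrix.of_apply, Matrix.one_apply, ← hab]
  ring

/-! ### The reduced dynamics -/

theorem IsState.ne_zero {η : Op} (h : IsState η) : η ≠ 0 := by
  rintro rfl
  simpa using h.2

theorem isState_or_eq_zero_of_posSemidef {A : Op} (hA : A.PosSemidef) :
    IsState (A.trace⁻¹ • A) ∨ A.trace⁻¹ • A = 0 := by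
  by_cases h : A.trace = 0
  · right; simp [h]
  · left
    have h0 : 0 ≤ A.trace⁻¹ := by
      have := hA.trace_nonneg
      rw [Complex.nonneg_iff] at this ⊢
      rw [Complex.inv_re, Complex.inv_im, ← this.2]
      exact ⟨div_nonneg this.1 (Complex.normSq_nonneg _), by simp⟩
    exact ⟨hA.smul h0, by rw [Matrix.trace_smul, smul_eq_mul, inv_mul_cancel₀ h]⟩

theorem ofReal_re_trace {A : Op} (hA : A.PosSemidef) : ((A.trace.re : ℝ) : ℂ) = A.trace :=
  (Complex.nonneg_iff.1 hA.trace_nonneg).elim fun _ h => Complex.ext rfl h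

section Trajectory

variable {d : ℕ} (n : ℕ) (U : ℕ → EuclideanSpace ℝ (Fin d) → unitaryGroup (Fin 2 × Fin 2) ℂ)
  (u : ℝ → Op → EuclideanSpace ℝ (Fin d)) (ρ : Op)

theorem transition_eq (k : ℕ) (i : Fin 2) (η : Op) :
    transition n U u k i η =
      kraus (stepUnitary n U u k η) i * η * (kraus (stepUnitary n U u k η) i)ᴴ :=
  partialTrace_conj _ _ _

@[simp]
theorem transition_zero (k : ℕ) (i : Fin 2) : transition n U u k i 0 = 0 := by
  simp [transition_eq]

theorem transition_posSemidef (k : ℕ) (i : Fin 2) {η : Op} (hη : η.PosSemidef) :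
    (transition n U u k i η).PosSemidef := by
  rw [transition_eq]
  exact hη.mul_mul_conjTranspose_same _

theorem trace_transition_add (k : ℕ) (η : Op) :
    (transition n U u k 0 η).trace + (transition n U u k 1 η).trace = η.trace := by
  have h := sum_kraus (U (k + 1) (u ((k : ℝ) / n) η)).2
  rw [transition_eq, transition_eq, Matrix.trace_mul_cycle,
    Matrix.trace_mul_cycle (kraus (stepUnitary n U u k η) 1), ← Matrix.trace_add,
    ← Matrix.add_mul]
  unfold stepUnitary
  rw [h, Matrix.one_mul]

/-- The atomic part of the non-normalized state after `k` measurements. -/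
def reducedState (ω : ℕ → Fin 2) : ℕ → Op
  | 0 => ρ
  | k + 1 =>
    let A := reducedState ω k
    let K := kraus (stepUnitary n U u k (A.trace⁻¹ • A)) (ω k)
    K * A * Kᴴ

/-- The configuration of the chain after `k` measurements with results `ω`. -/
def record (ω : ℕ → Fin 2) : ℕ → ℕ →₀ Fin 2
  | 0 => 0
  | k + 1 => (record ω k).update k (ω k)

theorem record_apply_of_le (ω : ℕ → Fin 2) {k j : ℕ} (h : k ≤ j) : record ω k j = 0 := by
  induction k with
  | zero => rfl
  | succ k ih =>
    rw [record, Finsupp.update_apply, if_neg (by omega), ih (by omega)]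

theorem trajectory_eq_of_embed {k : ℕ} {ω : ℕ → Fin 2} {A : Op} {c : ℕ →₀ Fin 2}
    (h : muTilde n U u ρ k ω = embed A c) : trajectory n U u ρ k ω = A.trace⁻¹ • A := by
  rw [trajectory, h, traceΓ_embed, smul_embed, E₀_embed]

/-- Moving the new interaction to the left of the earlier projections turns "all interactions, then
all projections" into a recursion with one interaction and one projection per step. -/
theorem muTilde_succ (k : ℕ) (ω : ℕ → Fin 2) :
    muTilde n U u ρ (k + 1) ω =
      (siteProj k (ω k) * amplify k (stepUnitary n U u k (trajectory n U u ρ k ω))) *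
        muTilde n U u ρ k ω *
        star (siteProj k (ω k) * amplify k (stepUnitary n U u k (trajectory n U u ρ k ω))) := by
  have h : projections ω (k + 1) * evolution n U u ρ ω (k + 1) =
      (siteProj k (ω k) * amplify k (stepUnitary n U u k (trajectory n U u ρ k ω))) *
        (projections ω k * evolution n U u ρ ω k) := by
    change siteProj k (ω k) * projections ω k *
      (amplify k (stepUnitary n U u k (trajectory n U u ρ k ω)) * evolution n U u ρ ω k) = _
    rw [mul_assoc, ← mul_assoc (projections ω k), projections_mul_amplify _ _ le_rfl]
    simp only [mul_assoc]
  have h' (j : ℕ) : muTilde n U u ρ j ω = (projections ω j * evolution n U u ρ ω j) *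
      initialState ρ * star (projections ω j * evolution n U u ρ ω j) := by
    simp only [muTilde, unnormalized, star_mul, mul_assoc]
  rw [h', h, h', star_mul]
  simp only [mul_assoc]

theorem muTilde_eq_embed (k : ℕ) (ω : ℕ → Fin 2) :
    muTilde n U u ρ k ω = embed (reducedState n U u ρ ω k) (record ω k) := by
  induction k with
  | zero =>
    simp only [muTilde, unnormalized, projections, evolution, star_one, mul_one, one_mul]
    rfl
  | succ k ih =>
    rw [muTilde_succ, trajectory_eq_of_embed n U u ρ ih, ih]
    exact conj_embed _ _ _ _ _ fun b =>
      siteProj_amplify_ket _ _ _ _ _ (record_apply_of_le ω le_rfl)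

theorem trajectory_eq (k : ℕ) (ω : ℕ → Fin 2) :
    trajectory n U u ρ k ω =
      (reducedState n U u ρ ω k).trace⁻¹ • reducedState n U u ρ ω k :=
  trajectory_eq_of_embed n U u ρ (muTilde_eq_embed n U u ρ k ω)

theorem traceΓ_muTilde (k : ℕ) (ω : ℕ → Fin 2) :
    traceΓ (muTilde n U u ρ k ω) = (reducedState n U u ρ ω k).trace := by
  rw [muTilde_eq_embed, traceΓ_embed]

theorem transition_trajectory (k : ℕ) (ω : ℕ → Fin 2) :
    transition n U u k (ω k) (trajectory n U u ρ k ω) =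
      (reducedState n U u ρ ω k).trace⁻¹ • reducedState n U u ρ ω (k + 1) := by
  rw [transition_eq, trajectory_eq, reducedState, Matrix.mul_smul, Matrix.smul_mul]

theorem trajectory_zero (hρ : IsState ρ) (ω : ℕ → Fin 2) : trajectory n U u ρ 0 ω = ρ := by
  rw [trajectory_eq]
  simp [reducedState, hρ.2]

variable {ρ}

theorem reducedState_posSemidef (hρ : ρ.PosSemidef) (ω : ℕ → Fin 2) (k : ℕ) :
    (reducedState n U u ρ ω k).PosSemidef := by
  induction k with
  | zero => exact hρ
  | succ k ih => exact ih.mul_mul_conjTranspose_same _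

theorem reducedState_succ_eq_zero (hρ : ρ.PosSemidef) {ω : ℕ → Fin 2} {k : ℕ}
    (h : (reducedState n U u ρ ω k).trace = 0) : reducedState n U u ρ ω (k + 1) = 0 := by
  rw [(reducedState_posSemidef n U u hρ ω k).trace_eq_zero_iff] at h
  simp [reducedState, h]

theorem trajectory_isState_or_eq_zero (hρ : ρ.PosSemidef) (k : ℕ) (ω : ℕ → Fin 2) :
    IsState (trajectory n U u ρ k ω) ∨ trajectory n U u ρ k ω = 0 := by
  rw [trajectory_eq]
  exact isState_or_eq_zero_of_posSemidef (reducedState_posSemidef n U u hρ ω k)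

/-- The one-step recursion: the factor normalizing the previous state cancels in the quotient. After
a zero trace both sides are `0`, by positivity and the convention on quotients. -/
theorem trajectory_succ (hρ : ρ.PosSemidef) (k : ℕ) (ω : ℕ → Fin 2) :
    trajectory n U u ρ (k + 1) ω =
      (transition n U u k (ω k) (trajectory n U u ρ k ω)).trace⁻¹ •
        transition n U u k (ω k) (trajectory n U u ρ k ω) := by
  rw [transition_trajectory, trajectory_eq]
  by_cases h : (reducedState n U u ρ ω k).trace = 0
  · simp [reducedState_succ_eq_zero n U u hρ h]
  · rw [Matrix.trace_smul, smul_smul, smul_eq_mul, mul_inv, inv_inv, mul_right_comm,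
      mul_inv_cancel₀ h, one_mul]

/-- Each factor is the ratio of successive traces, so the product telescopes; a zero trace persists
because a positive matrix of trace zero vanishes. -/
theorem traceΓ_muTilde_eq_prod (hρ : IsState ρ) (k : ℕ) (ω : ℕ → Fin 2) :
    traceΓ (muTilde n U u ρ k ω) =
      ∏ j ∈ Finset.range k, (transition n U u j (ω j) (trajectory n U u ρ j ω)).trace := by
  rw [traceΓ_muTilde]
  induction k with
  | zero => simpa [reducedState] using hρ.2
  | succ k ih =>
    rw [Finset.prod_range_succ, ← ih, transition_trajectory, Matrix.trace_smul, smul_eq_mul]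
    by_cases h : (reducedState n U u ρ ω k).trace = 0
    · simp [reducedState_succ_eq_zero n U u hρ.1 h]
    · rw [mul_inv_cancel_left₀ h]

/-- A trajectory that has reached the value `0` has gone through a transition of zero trace. -/
theorem exists_trace_eq_zero (hρ : IsState ρ) {k : ℕ} {ω : ℕ → Fin 2}
    (h : trajectory n U u ρ k ω = 0) :
    ∃ j < k, IsState (trajectory n U u ρ j ω) ∧
      (transition n U u j (ω j) (trajectory n U u ρ j ω)).trace = 0 := by
  induction k with
  | zero => exact absurd (trajectory_zero n U u ρ hρ ω ▸ h) hρ.ne_zero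
  | succ k ih =>
    rcases trajectory_isState_or_eq_zero n U u hρ.1 k ω with hk | hk
    · refine ⟨k, k.lt_succ_self, hk, ?_⟩
      by_contra hne
      rw [trajectory_succ n U u hρ.1] at h
      have := congr_arg Matrix.trace h
      simp [hne] at this
    · obtain ⟨j, hj, h'⟩ := ih hk
      exact ⟨j, by omega, h'⟩

theorem reducedState_congr {ω ω' : ℕ → Fin 2} {k : ℕ} (h : ∀ j < k, ω j = ω' j) :
    reducedState n U u ρ ω k = reducedState n U u ρ ω' k := by
  induction k with
  | zero => rfl
  | succ k ih =>
    rw [reducedState, reducedState, ih fun j hj => h j (by omega), h k k.lt_succ_self]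

theorem trajectory_congr {ω ω' : ℕ → Fin 2} {k : ℕ} (h : ∀ j < k, ω j = ω' j) :
    trajectory n U u ρ k ω = trajectory n U u ρ k ω' := by
  rw [trajectory_eq, trajectory_eq, reducedState_congr n U u h]

/-! ### The coupled process follows the trajectory of its own results -/

/-- The result of the step `k + 1` of the coupled process. -/
def result (N : Measure (ℝ × ℝ)) (k : ℕ) (η : Op) : Fin 2 :=
  open Classical in if 0 < N (region n U u k η) then 1 else 0

variable (ρ) in
/-- The sequence of results of the coupled process. -/
def results (N : Measure (ℝ × ℝ)) (k : ℕ) : Fin 2 :=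
  result n U u N k (coupled n U u ρ N k)

/-- Write `p_i = Tr ℒ_i`, with `p₀ + p₁ = 1`. If there is no point, the correction is `p₁ ℒ₀ / p₀ -
ℒ₁`, and the sum is `ℒ₀ / p₀`; the other case is symmetric. -/
theorem coupled_step {η : Op} (hη : IsState η ∨ η = 0) (N : Measure (ℝ × ℝ)) (k : ℕ) :
    transition n U u k 0 η + transition n U u k 1 η +
        (nuTilde n U u N k η - (transition n U u k 1 η).trace) •
          (-((transition n U u k 0 η).trace⁻¹ • transition n U u k 0 η) +
            (transition n U u k 1 η).trace⁻¹ • transition n U u k 1 η) =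
      (transition n U u k (result n U u N k η) η).trace⁻¹ •
        transition n U u k (result n U u N k η) η := by
  rcases hη with hη | rfl
  swap
  · simp
  have hsum := trace_transition_add n U u k η
  have h₀ := (transition_posSemidef n U u k 0 hη.1).trace_eq_zero_iff
  have h₁ := (transition_posSemidef n U u k 1 hη.1).trace_eq_zero_iff
  rw [hη.2] at hsum
  generalize hL₀ : transition n U u k 0 η = L₀ at *
  generalize hL₁ : transition n U u k 1 η = L₁ at *
  have key : ∀ z : ℂ, ∀ L : Op, (z = 0 ∧ L = L₀ ∨ z = 1 ∧ L = L₁) →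
      L₀ + L₁ + (z - L₁.trace) • (-(L₀.trace⁻¹ • L₀) + L₁.trace⁻¹ • L₁) = L.trace⁻¹ • L := by
    intro z L hz
    -- When one trace vanishes, positivity kills that matrix and the other trace is `1`; the
    -- identity then survives with the quotient read as `0`.
    by_cases e₀ : L₀.trace = 0
    · have e₁ : L₁.trace = 1 := by simpa [e₀] using hsum
      rw [h₀.1 e₀, e₁]
      rcases hz with ⟨rfl, rfl⟩ | ⟨rfl, rfl⟩
      · simp [h₀.1 e₀]
      · simp [e₁]
    by_cases e₁ : L₁.trace = 0
    · have e₀ : L₀.trace = 1 := by simpa [e₁] using hsum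
      rw [h₁.1 e₁, e₀]
      rcases hz with ⟨rfl, rfl⟩ | ⟨rfl, rfl⟩
      · simp [e₀]
      · simp [h₁.1 e₁]
    have x₀ := mul_inv_cancel₀ e₀
    have x₁ := mul_inv_cancel₀ e₁
    ext i j
    simp only [Matrix.add_apply, Matrix.smul_apply, Matrix.neg_apply, smul_eq_mul]
    rcases hz with ⟨rfl, rfl⟩ | ⟨rfl, rfl⟩
    · linear_combination (L i j * L.trace⁻¹) * hsum - L₁ i j * x₁ - L i j * x₀
    · linear_combination (L₀ i j * L₀.trace⁻¹) * hsum - L i j * x₁ - L₀ i j * x₀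
  apply key
  by_cases hN : 0 < N (region n U u k η)
  · right; simp [nuTilde, result, hN, hL₁]
  · left; simp [nuTilde, result, hN, hL₀]

theorem coupled_eq_trajectory (hρ : IsState ρ) (N : Measure (ℝ × ℝ)) (k : ℕ) :
    coupled n U u ρ N k = trajectory n U u ρ k (results n U u ρ N) := by
  induction k with
  | zero => exact (trajectory_zero n U u ρ hρ _).symm
  | succ k ih =>
    have h := trajectory_isState_or_eq_zero n U u hρ.1 k (results n U u ρ N)
    rw [← ih] at h
    rw [trajectory_succ n U u hρ.1, ← ih]
    exact coupled_step n U u h N k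

end Trajectory

/-! ### Void probabilities of the Poisson point process -/

theorem IsPoissonPointProcess.measurable_count {Ω E : Type*} [MeasurableSpace Ω]
    [MeasurableSpace E] {N : Ω → Measure E} {m : Measure E} {Pr : Measure Ω}
    (hN : IsPoissonPointProcess N m Pr) {B : Set E} (hB : MeasurableSet B) :
    Measurable fun ω => N ω B :=
  (Measure.measurable_coe hB).comp hN.measurable

theorem IsPoissonPointProcess.measure_void {Ω E : Type*} [MeasurableSpace Ω]
    [MeasurableSpace E] {N : Ω → Measure E} {m : Measure E} {Pr : Measure Ω}
    (hN : IsPoissonPointProcess N m Pr) {B : Set E} (hB : MeasurableSet B) (hm : m B ≠ ∞) :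
    Pr {ω | N ω B = 0} = ENNReal.ofReal (Real.exp (-(m B).toReal)) := by
  have h := congr_arg (fun μ : Measure ℝ≥0∞ => μ {0}) (hN.law B hB hm)
  rw [Measure.map_apply (hN.measurable_count hB) (measurableSet_singleton _),
    Measure.map_apply measurable_from_top (measurableSet_singleton _)] at h
  have h0 : (fun p : ℕ => (p : ℝ≥0∞)) ⁻¹' {0} = {0} := by ext; simp
  rw [h0, poissonMeasure_singleton] at h
  simp only [ENNReal.coe_toNNReal_eq_toReal, pow_zero, mul_one, Nat.factorial_zero, Nat.cast_one,
    div_one] at h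
  exact h

section Trajectory

variable {d : ℕ} (n : ℕ) (U : ℕ → EuclideanSpace ℝ (Fin d) → unitaryGroup (Fin 2 × Fin 2) ℂ)
  (u : ℝ → Op → EuclideanSpace ℝ (Fin d)) {ρ : Op}

theorem measurableSet_region (k : ℕ) (η : Op) : MeasurableSet (region n U u k η) := by
  refine (measurableSet_le measurable_const measurable_fst).inter
    ((measurableSet_lt measurable_fst measurable_const).inter
      ((measurableSet_le measurable_const measurable_snd).inter
        (measurableSet_le (measurable_coe_real_ereal.comp measurable_snd) measurable_const)))

theorem disjoint_region (hn : 0 < n) {j k : ℕ} (h : j < k) (η η' : Op) :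
    Disjoint (region n U u j η) (region n U u k η') := by
  refine Set.disjoint_left.2 fun x hx hy => ?_
  have h1 := hx.2.1
  have h2 := hy.1
  have h3 : ((j : ℝ) + 1) / n ≤ (k : ℝ) / n := by
    gcongr
    exact_mod_cast h
  linarith

theorem region_eq_of_pos {k : ℕ} {η : Op} (h : 0 < (transition n U u k 0 η).trace.re) :
    region n U u k η = Set.Ico ((k : ℝ) / n) (((k : ℝ) + 1) / n) ×ˢ
      Set.Icc 0 (-(n : ℝ) * Real.log (transition n U u k 0 η).trace.re) := by
  ext x
  simp only [region, ENNReal.log_ofReal_of_pos h, Set.mem_ofPred_eq, Set.mem_prod, Set.mem_Ico,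
    Set.mem_Icc]
  rw [← EReal.coe_neg, ← EReal.coe_mul, EReal.coe_le_coe_iff]
  tauto

theorem subset_region_of_nonpos (hn : 0 < n) {k : ℕ} {η : Op}
    (h : (transition n U u k 0 η).trace.re ≤ 0) (r : ℝ) :
    Set.Ico ((k : ℝ) / n) (((k : ℝ) + 1) / n) ×ˢ Set.Icc 0 r ⊆ region n U u k η := by
  rintro x ⟨⟨h1, h2⟩, h3, -⟩
  refine ⟨h1, h2, h3, ?_⟩
  rw [ENNReal.ofReal_eq_zero.2 h, ENNReal.log_zero, ← EReal.coe_neg,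
    EReal.coe_mul_bot_of_neg (by simpa using hn)]
  exact le_top

theorem toReal_volume_box (hn : 0 < n) (k : ℕ) {r : ℝ} (hr : 0 ≤ r) :
    (volume (Set.Ico ((k : ℝ) / n) (((k : ℝ) + 1) / n) ×ˢ Set.Icc 0 r)).toReal = r / n := by
  have h : ((k : ℝ) + 1) / n - (k : ℝ) / n = 1 / n := by ring
  rw [Measure.volume_eq_prod, Measure.prod_prod, Real.volume_Ico, Real.volume_Icc, h, sub_zero,
    ENNReal.toReal_mul, ENNReal.toReal_ofReal (by positivity), ENNReal.toReal_ofReal hr]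
  ring

theorem volume_box_ne_top (a b c r : ℝ) :
    volume (Set.Ico a b ×ˢ Set.Icc c r) ≠ ∞ := by
  rw [Measure.volume_eq_prod, Measure.prod_prod, Real.volume_Ico, Real.volume_Icc]
  exact ENNReal.mul_ne_top ENNReal.ofReal_ne_top ENNReal.ofReal_ne_top

theorem re_trace_transition_add (k : ℕ) {η : Op} (hη : IsState η) :
    (transition n U u k 0 η).trace.re + (transition n U u k 1 η).trace.re = 1 := by
  rw [← Complex.add_re, trace_transition_add, hη.2, Complex.one_re]

theorem re_trace_transition_nonneg (k : ℕ) (i : Fin 2) {η : Op} (hη : IsState η) :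
    0 ≤ (transition n U u k i η).trace.re :=
  (Complex.nonneg_iff.1 (transition_posSemidef n U u k i hη.1).trace_nonneg).1

variable {Ω : Type*} [MeasurableSpace Ω] {Pr : Measure Ω} {N : Ω → Measure (ℝ × ℝ)}

/-- The time width `1/n` cancels the factor `n` in the height, so the area is `-ln Tr ℒ_0` and the
void probability is its exponential `exp(ln Tr ℒ_0)`. -/
theorem measure_region_void (hN : IsPoissonPointProcess N volume Pr) (hn : 0 < n) (k : ℕ)
    {η : Op} (hη : IsState η) :
    Pr {ω | N ω (region n U u k η) = 0} =
      ENNReal.ofReal (transition n U u k 0 η).trace.re := by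
  have hn' : (0 : ℝ) < n := by exact_mod_cast hn
  rcases (re_trace_transition_nonneg n U u k 0 hη).lt_or_eq with h | h
  · have h1 : (transition n U u k 0 η).trace.re ≤ 1 := by
      linarith [re_trace_transition_add n U u k hη, re_trace_transition_nonneg n U u k 1 hη]
    have hlog := Real.log_nonpos h.le h1
    rw [region_eq_of_pos n U u h, hN.measure_void (measurableSet_Ico.prod measurableSet_Icc)
      (volume_box_ne_top _ _ _ _), toReal_volume_box n hn k (by nlinarith)]
    rw [neg_mul, neg_div, neg_neg, mul_div_cancel_left₀ _ hn'.ne', Real.exp_log h]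
  · rw [← h, ENNReal.ofReal_zero]
    -- Here the strip has infinite area, where the Poisson law is not prescribed. It contains boxes
    -- of every height `m`, whose void probabilities `exp(-m/n)` tend to `0`.
    have hle (m : ℕ) : Pr {ω | N ω (region n U u k η) = 0} ≤
        ENNReal.ofReal (Real.exp (-((m : ℝ) / n))) := by
      rw [← toReal_volume_box n hn k (Nat.cast_nonneg m),
        ← hN.measure_void (measurableSet_Ico.prod measurableSet_Icc) (volume_box_ne_top _ _ _ _)]
      exact measure_mono fun ω hω =>
        measure_mono_null (subset_region_of_nonpos n U u hn h.ge m) hω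
    refine le_antisymm (ge_of_tendsto' (x := Filter.atTop) ?_ hle) zero_le
    rw [← ENNReal.ofReal_zero]
    refine ENNReal.tendsto_ofReal (Real.tendsto_exp_neg_atTop_nhds_zero.comp ?_)
    exact tendsto_natCast_atTop_atTop.atTop_div_const hn'

/-! ### Results of the coupled process -/

/-- The set of numbers of points for which the result of a step is `i`. -/
def resultSet (i : Fin 2) : Set ℝ≥0∞ := if i = 0 then {0} else {0}ᶜ

theorem measurableSet_resultSet (i : Fin 2) : MeasurableSet (resultSet i) := by
  unfold resultSet
  split_ifs
  · exact measurableSet_singleton _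
  · exact (measurableSet_singleton _).compl

theorem result_eq_iff (μ : Measure (ℝ × ℝ)) (k : ℕ) (η : Op) (i : Fin 2) :
    result n U u μ k η = i ↔ μ (region n U u k η) ∈ resultSet i := by
  by_cases h : μ (region n U u k η) = 0 <;> fin_cases i <;>
    simp [result, resultSet, h, pos_iff_ne_zero]

theorem measure_result [IsProbabilityMeasure Pr] (hN : IsPoissonPointProcess N volume Pr)
    (hn : 0 < n) (k : ℕ) {η : Op} (hη : IsState η) (i : Fin 2) :
    (((Pr {ω | N ω (region n U u k η) ∈ resultSet i}).toReal : ℝ) : ℂ) =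
      (transition n U u k i η).trace := by
  have hvoid := measure_region_void n U u hN hn k hη
  rw [← ofReal_re_trace (transition_posSemidef n U u k i hη.1)]
  congr 1
  fin_cases i
  · simp only [resultSet, Fin.zero_eta, if_true, Set.mem_singleton_iff]
    rw [hvoid, ENNReal.toReal_ofReal (re_trace_transition_nonneg n U u k 0 hη)]
  · have hc : {ω | N ω (region n U u k η) ∈ resultSet 1} =
        {ω | N ω (region n U u k η) = 0}ᶜ := by ext; simp [resultSet]
    have hm : MeasurableSet {ω | N ω (region n U u k η) = 0} :=
      hN.measurable_count (measurableSet_region n U u k η) (measurableSet_singleton _)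
    simp only [Fin.mk_one]
    rw [hc, ← measureReal_def, probReal_compl_eq_one_sub hm, measureReal_def, hvoid,
      ENNReal.toReal_ofReal (re_trace_transition_nonneg n U u k 0 hη)]
    linarith [re_trace_transition_add n U u k hη]

/-- This removes the randomness of the regions: while the results agree with `i`, the state entering
step `j` is the deterministic `trajectory j i`. Independence of counts applies only to such fixed
sets. -/
theorem results_cylinder (hρ : IsState ρ) (μ : Measure (ℝ × ℝ)) (k : ℕ) (i : ℕ → Fin 2) :
    (∀ j < k, results n U u ρ μ j = i j) ↔
      ∀ j < k, μ (region n U u j (trajectory n U u ρ j i)) ∈ resultSet (i j) := by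
  simp only [← result_eq_iff]
  have h {j : ℕ} (hj : ∀ l < j, results n U u ρ μ l = i l) :
      results n U u ρ μ j = result n U u μ j (trajectory n U u ρ j i) := by
    rw [results, coupled_eq_trajectory n U u hρ, trajectory_congr n U u hj]
  induction k with
  | zero => simp
  | succ k ih =>
    simp only [Nat.forall_lt_succ_right, ← ih]
    exact and_congr_right fun hj => by rw [h hj]

theorem measurableSet_results_cylinder (hN : IsPoissonPointProcess N volume Pr) (hρ : IsState ρ)
    (k : ℕ) (i : ℕ → Fin 2) :
    MeasurableSet {ω | ∀ j < k, results n U u ρ (N ω) j = i j} := by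
  simp only [results_cylinder n U u hρ, Set.ofPred_forall]
  exact MeasurableSet.iInter fun j => MeasurableSet.iInter fun _ =>
    hN.measurable_count (measurableSet_region n U u j _) (measurableSet_resultSet _)

theorem measure_results_cylinder [IsProbabilityMeasure Pr]
    (hN : IsPoissonPointProcess N volume Pr) (hn : 0 < n) (hρ : IsState ρ) (k : ℕ)
    (i : ℕ → Fin 2) :
    ((Pr.real {ω | ∀ j < k, results n U u ρ (N ω) j = i j} : ℝ) : ℂ) =
      traceΓ (muTilde n U u ρ k i) := by
  have hind : Pr {ω | ∀ j < k, results n U u ρ (N ω) j = i j} = ∏ j : Fin k,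
      Pr {ω | N ω (region n U u j (trajectory n U u ρ j i)) ∈ resultSet (i j)} := by
    have h := hN.indep k (fun j => region n U u j (trajectory n U u ρ j i))
      (fun j => measurableSet_region n U u j _) fun j l hjl => by
        rcases lt_or_gt_of_ne hjl with h | h
        · exact disjoint_region n U u hn h _ _
        · exact (disjoint_region n U u hn h _ _).symm
    rw [iIndepFun_iff_measure_inter_preimage_eq_mul] at h
    have h' := h Finset.univ (sets := fun j => resultSet (i j))
      fun j _ => measurableSet_resultSet _
    refine Eq.trans (congr_arg Pr ?_) h'
    ext ω
    simp only [results_cylinder n U u hρ, Set.mem_ofPred_eq, Finset.mem_univ, Set.iInter_true,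
      Set.mem_iInter, Set.mem_preimage]
    exact ⟨fun h j => h j j.2, fun h j hj => h ⟨j, hj⟩⟩
  rw [measureReal_def, hind, ENNReal.toReal_prod, Complex.ofReal_prod,
    traceΓ_muTilde_eq_prod n U u hρ, ← Fin.prod_univ_eq_prod_range]
  -- Factors match one by one only at genuine states. If the trajectory along `i` has died, an
  -- earlier state had a transition of trace zero, and that factor annihilates both products.
  by_cases hall : ∀ j : Fin k, IsState (trajectory n U u ρ j i)
  · exact Finset.prod_congr rfl fun j _ => measure_result n U u hN hn j (hall j) (i j)
  · obtain ⟨l, hl⟩ := not_forall.1 hall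
    obtain ⟨j, hj, hs, h0⟩ := exists_trace_eq_zero n U u hρ
      ((trajectory_isState_or_eq_zero n U u hρ.1 l i).resolve_left hl)
    rw [Finset.prod_eq_zero (Finset.mem_univ (⟨j, hj.trans l.2⟩ : Fin k))
      ((measure_result n U u hN hn j hs (i j)).trans h0),
      Finset.prod_eq_zero (Finset.mem_univ (⟨j, hj.trans l.2⟩ : Fin k)) h0]

/-! ### The law of the measurement results -/

theorem generateFrom_cylinders :
    (MeasurableSpace.pi : MeasurableSpace (ℕ → Fin 2)) =
      MeasurableSpace.generateFrom {s | ∃ (x : ℕ → Fin 2) (k : ℕ), s = PiNat.cylinder x k} :=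
  (BorelSpace.measurable_eq (α := ℕ → Fin 2)).trans
    (PiNat.isTopologicalBasis_cylinders fun _ : ℕ => Fin 2).borel_eq_generateFrom

theorem isPiSystem_cylinders :
    IsPiSystem {s | ∃ (x : ℕ → Fin 2) (k : ℕ), s = PiNat.cylinder x k} := by
  rintro _ ⟨x, k, rfl⟩ _ ⟨y, l, rfl⟩ ⟨z, hx, hy⟩
  refine ⟨z, max k l, ?_⟩
  rw [← PiNat.mem_cylinder_iff_eq.1 hx, ← PiNat.mem_cylinder_iff_eq.1 hy]
  ext w
  simp only [Set.mem_inter_iff, PiNat.mem_cylinder_iff, lt_max_iff]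
  exact ⟨fun h j hj => hj.elim (h.1 j) (h.2 j),
    fun h => ⟨fun j hj => h j (.inl hj), fun j hj => h j (.inr hj)⟩⟩

theorem IsMeasurementLaw.ext {P Q : Measure (ℕ → Fin 2)} (hP : IsMeasurementLaw n U u ρ P)
    (hQ : IsMeasurementLaw n U u ρ Q) : P = Q := by
  have := hP.1
  have := hQ.1
  refine ext_of_generate_finite _ generateFrom_cylinders isPiSystem_cylinders ?_ (by simp)
  rintro _ ⟨x, k, rfl⟩
  have h : P.real (PiNat.cylinder x k) = Q.real (PiNat.cylinder x k) :=
    Complex.ofReal_injective ((hP.2 k x).trans (hQ.2 k x).symm)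
  exact (measureReal_eq_measureReal_iff).1 h

theorem measurable_results (hN : IsPoissonPointProcess N volume Pr) (hρ : IsState ρ) :
    Measurable fun ω => results n U u ρ (N ω) := by
  rw [generateFrom_cylinders]
  refine measurable_generateFrom ?_
  rintro _ ⟨x, k, rfl⟩
  exact measurableSet_results_cylinder n U u hN hρ k x

/-- Existence of the law comes from the Poisson process itself, with no extension theorem. -/
theorem isMeasurementLaw_map_results [IsProbabilityMeasure Pr]
    (hN : IsPoissonPointProcess N volume Pr) (hn : 0 < n) (hρ : IsState ρ) :
    IsMeasurementLaw n U u ρ (Pr.map fun ω => results n U u ρ (N ω)) := by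
  have hm := measurable_results n U u hN hρ
  refine ⟨Measure.isProbabilityMeasure_map hm.aemeasurable, fun k i => ?_⟩
  rw [← measure_results_cylinder n U u hN hn hρ k i, map_measureReal_apply hm]
  · rfl
  · exact (PiNat.isOpen_cylinder _ i k).measurableSet

/-- The state at time `k` depends only on the first `k` results, a finite set of possibilities, so
no regularity of `u`, `U` or `g` is needed. -/
theorem measurable_comp_trajectory {β : Type*} [MeasurableSpace β] (g : Op → β) (k : ℕ) :
    Measurable fun ω => g (trajectory n U u ρ k ω) := by
  have h : (fun ω => g (trajectory n U u ρ k ω)) =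
      (fun i : Fin k → Fin 2 =>
        g (trajectory n U u ρ k fun j => if h : j < k then i ⟨j, h⟩ else 0)) ∘ fun ω j => ω j := by
    funext ω
    exact congr_arg g (trajectory_congr n U u fun j hj => by simp [hj])
  rw [h]
  exact (measurable_of_finite _).comp (measurable_pi_lambda _ fun j => measurable_pi_apply _)

end Trajectory

end QuantumTrajectory

end

/-! ### Existence and uniqueness of the law, and equality in distribution -/

theorem mainTheorem8 {Ω : Type*} [MeasurableSpace Ω] (Pr : Measure Ω) [IsProbabilityMeasure Pr]
    (N : Ω → Measure (ℝ × ℝ))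
    (hN : QuantumTrajectory.IsPoissonPointProcess N (volume : Measure (ℝ × ℝ)) Pr)
    {d : ℕ} (n : ℕ) (hn : 0 < n)
    (U : ℕ → EuclideanSpace ℝ (Fin d) → Matrix.unitaryGroup (Fin 2 × Fin 2) ℂ)
    (u : ℝ → QuantumTrajectory.Op → EuclideanSpace ℝ (Fin d))
    (ρ : QuantumTrajectory.Op) (hρ : QuantumTrajectory.IsState ρ)
    (T : ℝ) (hT : 0 ≤ T) :
    (∃! P : Measure (ℕ → Fin 2), QuantumTrajectory.IsMeasurementLaw n U u ρ P) ∧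
    ∀ P : Measure (ℕ → Fin 2), QuantumTrajectory.IsMeasurementLaw n U u ρ P →
      IdentDistrib
        (fun (ω : Ω) (k : Fin (⌊(n : ℝ) * T⌋₊ + 1)) (i j : Fin 2) =>
          QuantumTrajectory.coupled n U u ρ (N ω) k i j)
        (fun (ω : ℕ → Fin 2) (k : Fin (⌊(n : ℝ) * T⌋₊ + 1)) (i j : Fin 2) =>
          QuantumTrajectory.trajectory n U u ρ k ω i j)
        Pr P := by
  have hlaw := QuantumTrajectory.isMeasurementLaw_map_results n U u hN hn hρ
  refine ⟨⟨_, hlaw, fun Q hQ => hQ.ext n U u hlaw⟩, fun P hP => ?_⟩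
  rw [hP.ext n U u hlaw]
  have hR := QuantumTrajectory.measurable_results n U u hN hρ
  have hY : Measurable fun (ω : ℕ → Fin 2) (k : Fin (⌊(n : ℝ) * T⌋₊ + 1)) (i j : Fin 2) =>
      QuantumTrajectory.trajectory n U u ρ k ω i j :=
    measurable_pi_lambda _ fun k => measurable_pi_lambda _ fun i => measurable_pi_lambda _ fun j =>
      QuantumTrajectory.measurable_comp_trajectory n U u (fun η => η i j) k
  simp only [QuantumTrajectory.coupled_eq_trajectory n U u hρ]
  -- The coupled process is the trajectory composed with the results map, and `P` is the image of
  -- `Pr` under that map.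
  exact ⟨(hY.comp hR).aemeasurable, hY.aemeasurable, (Measure.map_map hY hR).symm⟩
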